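/- Rings are associative with identity $1$, not necessarily commutative. For a ring $R$, let $J(R)$ be its Jacobson radical and $M_n(R)$ the ring of $n\times n$ matrices over $R$. Call $R$ \emph{2-primal} if its set of nilpotent elements equals its prime radical (the intersection of all prime two-sided ideals of $R$). An element of $R$ is \emph{nil-clean} if it is the sum of an idempotent and a nilpotent of $R$, and \emph{strongly nil-clean} if in addition these two can be chosen to commute; $R$ is \emph{(strongly) nil-clean} if all its elements are, and \emph{generalized nil-clean} (GNC) if every non-unit of $R$ is nil-clean. A ring is \emph{Boolean} if all its elements are idempotent. \textbf{Proposition.} Let $R$ be a 2-primal ring and let $n\ge 2$ be an integer. Then $M_n(R)$ is GNC if and only if $R/J(R)$ is Boolean and $J(R)$ is nil (every element of $J(R)$ is nilpotent). Hence $M_n(R)$ is GNC if and only if $R$ is strongly nil-clean, and also if and only if $R$ is nil-clean. -/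

import Mathlib

/-- An element of a ring is nil-clean if it is the sum of an idempotent and a nilpotent. -/
def IsNilCleanElem {R : Type*} [Ring R] (a : R) : Prop :=
  ∃ e q : R, IsIdempotentElem e ∧ IsNilpotent q ∧ a = e + q

/-- An element of a ring is strongly nil-clean if it is the sum of an idempotent and a nilpotent
that commute with each other (equivalently, the idempotent commutes with the element). -/
def IsStronglyNilCleanElem {R : Type*} [Ring R] (a : R) : Prop :=
  ∃ e q : R, IsIdempotentElem e ∧ IsNilpotent q ∧ Commute e q ∧ a = e + q

/-- A ring is nil-clean if each of its elements is nil-clean. -/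
def IsNilCleanRing (R : Type*) [Ring R] : Prop :=
  ∀ a : R, IsNilCleanElem a

/-- A ring is strongly nil-clean if each of its elements is strongly nil-clean. -/
def IsStronglyNilCleanRing (R : Type*) [Ring R] : Prop :=
  ∀ a : R, IsStronglyNilCleanElem a

/-- A ring is generalized nil-clean (GNC) if each of its non-units is nil-clean. -/
def IsGNCRing (R : Type*) [Ring R] : Prop :=
  ∀ a : R, ¬ IsUnit a → IsNilCleanElem a

/-- A two-sided ideal `P` of a (not necessarily commutative) ring is prime if it is proper and,
for all two-sided ideals `A` and `B`, `A B ⊆ P` implies `A ⊆ P` or `B ⊆ P`. -/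
def IsPrimeTwoSided {R : Type*} [Ring R] (P : TwoSidedIdeal R) : Prop :=
  P ≠ ⊤ ∧ ∀ A B : TwoSidedIdeal R, (∀ a ∈ A, ∀ b ∈ B, a * b ∈ P) → A ≤ P ∨ B ≤ P

/-- The prime radical (lower nilradical) of a ring: the intersection of all its prime two-sided
ideals. -/
def primeRadical (R : Type*) [Ring R] : TwoSidedIdeal R :=
  sInf {P : TwoSidedIdeal R | IsPrimeTwoSided P}

/-- A ring is 2-primal if its set of nilpotent elements coincides with its prime radical. -/
def IsTwoPrimal (R : Type*) [Ring R] : Prop :=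
  {a : R | IsNilpotent a} = (primeRadical R : Set R)

/-- A ring is Boolean if each of its elements is idempotent. -/
def IsBooleanRing (R : Type*) [Ring R] : Prop :=
  ∀ a : R, IsIdempotentElem a

/-! The pivot is the condition that `a - a ^ 2` is nilpotent for every `a : R`; for 2-primal `R`
each condition in the theorem is equivalent to it.

From it, `R` modulo its prime radical is Boolean. Matrices over a Boolean ring are glued from
matrices over the field with two elements, which are nil-clean by a cyclic-basis argument. A matrix
with entries in the prime radical is nilpotent, so idempotents lift and `M_n(R)` is nil-clean.

Conversely, let `M_n(R)` be GNC and pass to the reduced quotient by the prime radical. GNC rings are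
exchange, exchange descends to the corner, and in a reduced exchange ring every maximal left ideal
`L` is two-sided, with division ring quotient. For `n ≥ 2` the matrix with single entry `a` at a
diagonal place is a non-unit, hence nil-clean, and over a division ring this forces `a = 0` or `a =
1`. So `a ^ 2 - a` lies in every `L`, hence in the Jacobson radical, which is nil, hence zero. -/

theorem IsNilCleanElem.map {R S : Type*} [Ring R] [Ring S] (f : R →+* S) {a : R}
    (h : IsNilCleanElem a) : IsNilCleanElem (f a) := by
  obtain ⟨e, q, he, hq, rfl⟩ := h
  exact ⟨f e, f q, he.map f, hq.map f, map_add f e q⟩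

theorem IsNilCleanElem.of_isNilpotent {R : Type*} [Ring R] {a : R} (h : IsNilpotent a) :
    IsNilCleanElem a :=
  ⟨0, a, IsIdempotentElem.zero, h, (zero_add a).symm⟩

theorem IsNilCleanElem.of_isNilpotent_sub_one {R : Type*} [Ring R] {a : R}
    (h : IsNilpotent (a - 1)) : IsNilCleanElem a :=
  ⟨1, a - 1, IsIdempotentElem.one, h, (add_sub_cancel 1 a).symm⟩

/-! ### Nil-clean endomorphisms: invariant subspaces and shifts -/

section LinearAlgebra

open Module

variable {K V : Type*} [Field K] [AddCommGroup V] [Module K V]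

/-- If `T` preserves `W`, nil-cleanness of `T` on `W` and on `V ⧸ W` gives that of `T`. -/
theorem IsNilCleanElem.of_restrict_of_mapQ {T : End K V} {W : Submodule K V}
    (hW : ∀ x ∈ W, T x ∈ W) (h₁ : IsNilCleanElem (R := End K W) (T.restrict hW))
    (h₂ : IsNilCleanElem (R := End K (V ⧸ W)) (W.mapQ W T hW)) : IsNilCleanElem T := by
  obtain ⟨E₁, Q₁, hE₁, ⟨m₁, hQ₁⟩, hT₁⟩ := h₁
  obtain ⟨E₂, Q₂, hE₂, ⟨m₂, hQ₂⟩, hT₂⟩ := h₂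
  obtain ⟨s, hs⟩ := LinearMap.exists_rightInverse_of_surjective W.mkQ W.range_mkQ
  replace hs : ∀ y, W.mkQ (s y) = y := fun y => LinearMap.congr_fun hs y
  have hker : ∀ x, W.mkQ x = 0 → x ∈ W := fun x => (Submodule.Quotient.mk_eq_zero W).mp
  have hmem : ∀ x, x - s (W.mkQ x) ∈ W := fun x => hker _ (by rw [map_sub, hs, sub_self])
  let p : V →ₗ[K] W := LinearMap.codRestrict W (LinearMap.id - s ∘ₗ W.mkQ) hmem
  have hp : ∀ x, (p x : V) = x - s (W.mkQ x) := fun x => rfl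
  have hmk : ∀ x : W, W.mkQ (x : V) = 0 := fun x => by simp
  have hpW : ∀ x : W, p x = x := fun x => Subtype.ext (by rw [hp, hmk, map_zero, sub_zero])
  have hps : ∀ y, p (s y) = 0 := fun y => Subtype.ext (by rw [hp, hs, sub_self]; rfl)
  -- `E` is block diagonal for `V = W ⊕ s(V ⧸ W)`; `T - E` is block triangular with diagonal blocks
  -- `Q₁`, `Q₂`, whatever the off-diagonal block of `T`.
  let E : End K V := W.subtype ∘ₗ E₁ ∘ₗ p + s ∘ₗ E₂ ∘ₗ W.mkQ
  have hE : ∀ x, E x = (E₁ (p x) : V) + s (E₂ (W.mkQ x)) := fun x => rfl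
  have hEW : ∀ x : W, E x = (E₁ x : V) := fun x => by rw [hE, hpW, hmk]; simp
  have hmkE : ∀ x, W.mkQ (E x) = E₂ (W.mkQ x) := fun x => by rw [hE, map_add, hmk, hs, zero_add]
  have hQW : ∀ x : W, (T - E) x = (Q₁ x : V) := fun x => by
    have h := congrArg Subtype.val (LinearMap.congr_fun hT₁ x)
    rw [LinearMap.sub_apply, hEW]
    simp only [LinearMap.coe_restrict_apply, LinearMap.add_apply, Submodule.coe_add] at h
    rw [h, add_sub_cancel_left]
  have hmkQ : ∀ x, W.mkQ ((T - E) x) = Q₂ (W.mkQ x) := fun x => by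
    have h := LinearMap.congr_fun hT₂ (W.mkQ x)
    rw [LinearMap.sub_apply, map_sub, hmkE]
    simp only [Submodule.mkQ_apply, Submodule.mapQ_apply, LinearMap.add_apply] at h ⊢
    rw [h, add_sub_cancel_left]
  refine ⟨E, T - E, LinearMap.ext fun x => ?_, ⟨m₁ + m₂, LinearMap.ext fun x => ?_⟩,
    (add_sub_cancel E T).symm⟩
  · rw [Module.End.mul_apply, hE (E x), hmkE]
    have h₁ : p (E x) = E₁ (p x) := by rw [hE, map_add, hpW, hps, add_zero]
    rw [h₁, ← Module.End.mul_apply, ← Module.End.mul_apply, hE₁.eq, hE₂.eq, hE]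
  · have hW' : ∀ m (x : W), ((T - E) ^ m) x = ((Q₁ ^ m) x : V) := by
      intro m
      induction m with
      | zero => intro x; rfl
      | succ m ih => intro x; rw [pow_succ, pow_succ, Module.End.mul_apply, Module.End.mul_apply,
          hQW, ih]
    have hm' : ∀ m x, W.mkQ (((T - E) ^ m) x) = (Q₂ ^ m) (W.mkQ x) := by
      intro m
      induction m with
      | zero => intro x; rfl
      | succ m ih => intro x; rw [pow_succ, pow_succ, Module.End.mul_apply, Module.End.mul_apply,
          ih, hmkQ]
    have hx : ((T - E) ^ m₂) x ∈ W := hker _ (by rw [hm', hQ₂, LinearMap.zero_apply])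
    rw [pow_add, Module.End.mul_apply, hW' m₁ ⟨_, hx⟩, hQ₁]
    rfl

/-- An endomorphism which, in a suitable basis `w 0, …, w (k - 1)`, differs from the shift by
an operator that is the identity on the span of the first `r` vectors and maps everything into
this span is nil-clean. -/
theorem IsNilCleanElem.of_shift [FiniteDimensional K V] {T : End K V}
    (hT : ∀ W : Submodule K V, (∀ x ∈ W, T x ∈ W) → W = ⊥ ∨ W = ⊤)
    {k r : ℕ} (hk : finrank K V = k) (w : ℕ → V) (hw₀ : w 0 ≠ 0) (hwk : w k = 0) (hr : r < k)
    (h₁ : ∀ i < r, T (w i) = w i + w (i + 1))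
    (h₂ : ∀ i < k, r ≤ i → T (w i) - w (i + 1) ∈ Submodule.span K (w '' Set.Iio r)) :
    IsNilCleanElem T := by
  have hk0 : 0 < k := by omega
  let b' : Fin k → V := fun i => w i
  have hmemw : ∀ i ≤ k, w i ∈ Submodule.span K (Set.range b') := by
    intro i hi
    rcases hi.lt_or_eq with hi | rfl
    · exact Submodule.subset_span ⟨⟨i, hi⟩, rfl⟩
    · rw [hwk]; exact zero_mem _
  have hle : Submodule.span K (w '' Set.Iio r) ≤ Submodule.span K (Set.range b') := by
    rw [Submodule.span_le]
    rintro _ ⟨i, hi, rfl⟩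
    exact hmemw i (by simp only [Set.mem_Iio] at hi; omega)
  have hsub : ∀ i < k, T (w i) - w (i + 1) ∈ Submodule.span K (w '' Set.Iio r) := by
    intro i hi
    by_cases hir : i < r
    · rw [h₁ i hir, add_sub_cancel_right]
      exact Submodule.subset_span ⟨i, hir, rfl⟩
    · exact h₂ i hi (not_lt.mp hir)
  -- The span is `T`-invariant and contains `w 0 ≠ 0`.
  have hspan : Submodule.span K (Set.range b') = ⊤ := by
    refine (hT _ fun x hx => ?_).resolve_left fun h => hw₀ ?_
    · induction hx using Submodule.span_induction with
      | mem x hx =>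
        obtain ⟨i, rfl⟩ := hx
        rw [← sub_add_cancel (T (b' i)) (w (i + 1))]
        exact add_mem (hle (hsub i i.2)) (hmemw _ i.2)
      | zero => rw [map_zero]; exact zero_mem _
      | add x y _ _ hx hy => rw [map_add]; exact add_mem hx hy
      | smul a x _ hx => rw [map_smul]; exact Submodule.smul_mem _ _ hx
    · simpa [h] using hmemw 0 hk0.le
  let b : Basis (Fin k) K V := basisOfTopLeSpanOfCardEqFinrank b' hspan.ge (by simp [hk])
  have hb : ∀ i, b i = w i := fun i => by simp [b, b']
  -- The shift `Q` is nilpotent because `w k = 0`, and `T - Q` is a projection onto the span of the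
  -- first `r` vectors.
  let Q : End K V := b.constr K fun i => w (i + 1)
  have hQ : ∀ i < k, Q (w i) = w (i + 1) := fun i hi => by
    have := b.constr_basis K (fun i => w (i + 1)) ⟨i, hi⟩
    rwa [hb] at this
  have hE₁ : ∀ x ∈ Submodule.span K (w '' Set.Iio r), (T - Q) x = x := by
    intro x hx
    induction hx using Submodule.span_induction with
    | mem x hx =>
      obtain ⟨i, hi, rfl⟩ := hx
      simp only [Set.mem_Iio] at hi
      rw [LinearMap.sub_apply, h₁ i hi, hQ i (by omega), add_sub_cancel_right]
    | zero => rw [map_zero]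
    | add x y _ _ hx hy => rw [map_add, hx, hy]
    | smul a x _ hx => rw [map_smul, hx]
  have hQpow : ∀ m i, i + m = k → (Q ^ m) (w i) = 0 := by
    intro m
    induction m with
    | zero => rintro i rfl; simpa using hwk
    | succ m ih =>
      intro i hi
      rw [pow_succ, Module.End.mul_apply, hQ i (by omega), ih (i + 1) (by omega)]
  refine ⟨T - Q, Q, b.ext fun i => ?_, ⟨k, b.ext fun i => ?_⟩, (sub_add_cancel T Q).symm⟩
  · rw [hb, Module.End.mul_apply]
    refine hE₁ _ ?_
    rw [LinearMap.sub_apply, hQ i i.2]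
    exact hsub i i.2
  · rw [hb, LinearMap.zero_apply]
    have h := congrArg (Q ^ (i : ℕ)) (hQpow (k - i) i (by omega))
    rwa [map_zero, ← Module.End.mul_apply, ← pow_add, Nat.add_sub_cancel' i.2.le] at h

end LinearAlgebra

/-! ### Matrices over the field with two elements -/

section ZModTwo

open Module Polynomial

variable {V : Type*} [AddCommGroup V] [Module (ZMod 2) V]

/-- Over the field with two elements, an endomorphism of a finite-dimensional space without
proper nonzero invariant subspaces is nil-clean. -/
theorem IsNilCleanElem.of_forall_invariant_eq_bot_or_top [FiniteDimensional (ZMod 2) V]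
    {T : End (ZMod 2) V}
    (hT : ∀ W : Submodule (ZMod 2) V, (∀ x ∈ W, T x ∈ W) → W = ⊥ ∨ W = ⊤) :
    IsNilCleanElem T := by
  rcases subsingleton_or_nontrivial V with hV | hV
  · exact .of_isNilpotent ⟨1, LinearMap.ext fun x => Subsingleton.elim _ _⟩
  obtain ⟨v, hv⟩ := exists_ne (0 : V)
  obtain ⟨m, hm⟩ : ∃ m, finrank (ZMod 2) V = m + 1 :=
    ⟨finrank (ZMod 2) V - 1, (Nat.succ_pred_eq_of_pos finrank_pos).symm⟩
  have h2 : ∀ x : V, x + x = 0 := fun x => by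
    rw [← two_smul (ZMod 2) x, show (2 : ZMod 2) = 0 from rfl, zero_smul]
  let S : End (ZMod 2) V := T - 1
  have hTS : ∀ x, T x = x + S x := fun x => by simp [S]
  have hSS : ∀ i x, S ((S ^ i) x) = (S ^ (i + 1)) x := fun i x => by
    rw [pow_succ', Module.End.mul_apply]
  have hCH : ∀ x, (∑ i ∈ Finset.range m, S.charpoly.coeff i • (S ^ i) x) +
      S.charpoly.coeff m • (S ^ m) x + (S ^ (m + 1)) x = 0 := by
    intro x
    have h := LinearMap.congr_fun (LinearMap.aeval_self_charpoly S) x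
    have hd : S.charpoly.natDegree = m + 1 := by rw [LinearMap.charpoly_natDegree, hm]
    have hc : S.charpoly.coeff (m + 1) = 1 := by rw [← hd]; exact S.charpoly_monic
    rw [aeval_eq_sum_range, hd, Finset.sum_range_succ, Finset.sum_range_succ, hc] at h
    simpa [LinearMap.sum_apply] using h
  have hF2 : ∀ a : ZMod 2, a = 0 ∨ a = 1 := by decide
  have hsum : ∀ r, ∑ i ∈ Finset.range r, S.charpoly.coeff i • (S ^ i) v ∈
      Submodule.span (ZMod 2) ((fun i => (S ^ i) v) '' Set.Iio r) := fun r =>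
    Submodule.sum_mem _ fun i hi => Submodule.smul_mem _ _
      (Submodule.subset_span ⟨i, Finset.mem_range.mp hi, rfl⟩)
  -- This coefficient is the trace of `S`. The trace of `T` equals the rank of the idempotent mod 2,
  -- so rank `dim V - 1` fits coefficient 1, and rank `dim V` or `dim V - 2` fits coefficient 0.
  rcases hF2 (S.charpoly.coeff m) with hc | hc
  · simp only [hc, zero_smul, add_zero] at hCH
    rcases m with _ | _ | m
    · refine .of_isNilpotent_sub_one ⟨1, LinearMap.ext fun x => ?_⟩
      simpa [S] using hCH x
    · simp only [zero_add, Finset.range_one, Finset.sum_singleton, pow_zero,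
        Module.End.one_apply] at hCH
      rcases hF2 (S.charpoly.coeff 0) with hc₀ | hc₀
      · refine .of_isNilpotent_sub_one ⟨2, LinearMap.ext fun x => ?_⟩
        simpa [hc₀] using hCH x
      · refine .of_isNilpotent ⟨2, LinearMap.ext fun x => ?_⟩
        have h := hCH x
        rw [hc₀, one_smul, pow_two, Module.End.mul_apply] at h
        rw [pow_two, Module.End.mul_apply, hTS, hTS, map_add, LinearMap.zero_apply]
        rw [show x + S x + (S x + S (S x)) = x + S (S x) + (S x + S x) by abel, h, h2, add_zero]
    · set c := S.charpoly.coeff (m + 1)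
      set u := ∑ i ∈ Finset.range (m + 1), S.charpoly.coeff i • (S ^ i) v with hu
      have hCHv : (S ^ (m + 3)) v = u + c • (S ^ (m + 1)) v := by
        have h := hCH v
        rw [Finset.sum_range_succ, ← hu] at h
        rw [← add_zero (u + c • (S ^ (m + 1)) v), ← h2 ((S ^ (m + 3)) v), ← add_assoc]
        exact (zero_add _).symm.trans (congrArg (· + (S ^ (m + 3)) v) h.symm)
      -- The last vector agrees with `T (w (m + 1))` modulo the first `m + 1` vectors. The
      -- correction `(c + 1) • (S ^ m) v` is chosen to cancel the `(S ^ (m + 1)) v` terms of `T (w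
      -- (m + 2))`.
      let w : ℕ → V := fun i => if i < m + 2 then (S ^ i) v else
        if i = m + 2 then (S ^ (m + 1)) v + (S ^ (m + 2)) v - (c + 1) • (S ^ m) v else 0
      have hw : ∀ i < m + 2, w i = (S ^ i) v := fun i hi => if_pos hi
      have hw₂ : w (m + 2) = (S ^ (m + 1)) v + (S ^ (m + 2)) v - (c + 1) • (S ^ m) v := by
        simp [w]
      have hw₃ : w (m + 3) = 0 := by simp [w]
      have himg : w '' Set.Iio (m + 1) = (fun i => (S ^ i) v) '' Set.Iio (m + 1) :=
        Set.image_congr fun i hi => hw i (by simp only [Set.mem_Iio] at hi; omega)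
      have hmem : (S ^ m) v ∈ Submodule.span (ZMod 2) (w '' Set.Iio (m + 1)) := by
        rw [himg]; exact Submodule.subset_span ⟨m, by simp, rfl⟩
      refine .of_shift hT (k := m + 3) (r := m + 1) hm w (by simpa [w] using hv) hw₃ (by omega)
        (fun i hi => ?_) fun i hi hri => ?_
      · rw [hw i (by omega), hw (i + 1) (by omega), hTS, hSS]
      · obtain rfl | rfl : i = m + 1 ∨ i = m + 2 := by omega
        · rw [hw₂, hw (m + 1) (by omega), hTS, hSS, sub_sub_cancel]
          exact Submodule.smul_mem _ _ hmem
        · have h : T (w (m + 2)) - w (m + 3) = u - (c + 1) • (S ^ m) v := by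
            rw [hw₂, hw₃, sub_zero, hTS]
            simp only [map_add, map_sub, map_smul, hSS, hCHv, add_smul, one_smul]
            have e := h2 ((S ^ (m + 2)) v)
            rw [show (S ^ (m + 1)) v + (S ^ (m + 2)) v - (c • (S ^ m) v + (S ^ m) v) +
              ((S ^ (m + 2)) v + (u + c • (S ^ (m + 1)) v) -
              (c • (S ^ (m + 1)) v + (S ^ (m + 1)) v)) =
              (S ^ (m + 2)) v + (S ^ (m + 2)) v + (u - (c • (S ^ m) v + (S ^ m) v)) by abel, e,
              zero_add]
          rw [h]
          exact sub_mem (himg ▸ hsum _) (Submodule.smul_mem _ _ hmem)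
  · let w : ℕ → V := fun i => if i < m + 1 then (S ^ i) v else 0
    have hw : ∀ i < m + 1, w i = (S ^ i) v := fun i hi => if_pos hi
    have hw₁ : w (m + 1) = 0 := by simp [w]
    have himg : w '' Set.Iio m = (fun i => (S ^ i) v) '' Set.Iio m :=
      Set.image_congr fun i hi => hw i (by simp only [Set.mem_Iio] at hi; omega)
    refine .of_shift hT (k := m + 1) (r := m) hm w (by simpa [w] using hv) hw₁ (by omega)
      (fun i hi => ?_) fun i hi hri => ?_
    · rw [hw i (by omega), hw (i + 1) (by omega), hTS, hSS]
    · obtain rfl : i = m := by omega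
      rw [hw i hi, hw₁, sub_zero, hTS, hSS, himg]
      have h := hCH v
      rw [hc, one_smul, add_assoc] at h
      rw [← neg_eq_of_add_eq_zero_right h]
      exact neg_mem (hsum _)

/-- Over the field with two elements, every endomorphism of a finite-dimensional space is
nil-clean. -/
theorem isNilCleanRing_end_zmod_two (V : Type*) [AddCommGroup V] [Module (ZMod 2) V]
    [FiniteDimensional (ZMod 2) V] : IsNilCleanRing (End (ZMod 2) V) := by
  induction hd : finrank (ZMod 2) V using Nat.strong_induction_on generalizing V with
  | _ d ih =>
  intro T
  by_cases hT : ∀ W : Submodule (ZMod 2) V, (∀ x ∈ W, T x ∈ W) → W = ⊥ ∨ W = ⊤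
  · exact .of_forall_invariant_eq_bot_or_top hT
  · push Not at hT
    obtain ⟨W, hW, hbot, htop⟩ := hT
    have h₁ := W.finrank_quotient_add_finrank
    have h₂ : finrank (ZMod 2) W ≠ 0 := fun h => hbot (Submodule.finrank_eq_zero.mp h)
    have h₃ := Submodule.finrank_lt htop
    exact .of_restrict_of_mapQ hW (ih _ (by omega) W rfl _) (ih _ (by omega) (V ⧸ W) rfl _)

theorem isNilCleanRing_matrix_zmod_two (n : ℕ) :
    IsNilCleanRing (Matrix (Fin n) (Fin n) (ZMod 2)) := fun A => by
  have h := (isNilCleanRing_end_zmod_two (Fin n → ZMod 2) (Matrix.toLinAlgEquiv' A)).map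
    (Matrix.toLinAlgEquiv' (R := ZMod 2) (n := Fin n)).symm.toRingEquiv.toRingHom
  simpa using h

end ZModTwo

/-! ### Matrices over Boolean rings -/

section Boolean

variable {B : Type*} [BooleanRing B]

/-- `b` and `1 - b` are orthogonal central idempotents, so products are computed separately on the
two components. -/
theorem IsNilCleanElem.smul_add_one_sub_smul {ι : Type*} [Fintype ι] [DecidableEq ι]
    {A₁ A₂ : Matrix ι ι B} (h₁ : IsNilCleanElem A₁) (h₂ : IsNilCleanElem A₂) (b : B) :
    IsNilCleanElem (b • A₁ + (1 - b) • A₂) := by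
  obtain ⟨E₁, Q₁, hE₁, ⟨m₁, hQ₁⟩, rfl⟩ := h₁
  obtain ⟨E₂, Q₂, hE₂, ⟨m₂, hQ₂⟩, rfl⟩ := h₂
  have hb : b * b = b := BooleanRing.mul_self b
  have hb' : (1 - b) * (1 - b) = 1 - b := BooleanRing.mul_self _
  have h0 : b * (1 - b) = 0 := by rw [mul_sub, mul_one, hb, sub_self]
  have h0' : (1 - b) * b = 0 := by rw [mul_comm, h0]
  have hmul : ∀ X₁ X₂ Y₁ Y₂ : Matrix ι ι B, (b • X₁ + (1 - b) • X₂) * (b • Y₁ + (1 - b) • Y₂) =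
      b • (X₁ * Y₁) + (1 - b) • (X₂ * Y₂) := by
    intro X₁ X₂ Y₁ Y₂
    simp only [add_mul, mul_add, smul_mul_smul_comm, hb, hb', h0, h0', zero_smul, add_zero,
      zero_add]
  refine ⟨b • E₁ + (1 - b) • E₂, b • Q₁ + (1 - b) • Q₂, ?_, ⟨m₁ + m₂, ?_⟩, ?_⟩
  · rw [IsIdempotentElem, hmul, hE₁.eq, hE₂.eq]
  · have hpow : ∀ m, (b • Q₁ + (1 - b) • Q₂) ^ m = b • Q₁ ^ m + (1 - b) • Q₂ ^ m := by
      intro m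
      induction m with
      | zero => rw [pow_zero, pow_zero, pow_zero, ← add_smul, add_sub_cancel, one_smul]
      | succ m ih => rw [pow_succ, ih, hmul, pow_succ, pow_succ]
    rw [hpow, pow_add, pow_add, hQ₁, hQ₂, zero_mul, mul_zero, smul_zero, smul_zero, add_zero]
  · rw [smul_add, smul_add]; abel

/-- Matrix rings over Boolean rings are nil-clean. -/
theorem isNilCleanRing_matrix_boolean (n : ℕ) : IsNilCleanRing (Matrix (Fin n) (Fin n) B) := by
  rcases subsingleton_or_nontrivial B with hB | hB
  · exact fun A => .of_isNilpotent ⟨1, Subsingleton.elim _ _⟩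
  have : CharP B 2 := CharTwo.of_one_ne_zero_of_two_eq_zero one_ne_zero
    (by rw [← one_add_one_eq_two]; exact BooleanRing.add_self 1)
  -- `s` holds the places whose entries may differ from 0 and 1. A place with entry `b` is removed
  -- by writing the matrix as `b` times its version with entry 1 there plus `1 - b` times its
  -- version with entry 0.
  have key : ∀ (s : Finset (Fin n × Fin n)) (A : Matrix (Fin n) (Fin n) B),
      (∀ i j, (i, j) ∉ s → A i j = 0 ∨ A i j = 1) → IsNilCleanElem A := by
    intro s
    induction s using Finset.induction_on with
    | empty =>
      intro A hA
      classical
      let f := ZMod.castHom (dvd_refl 2) B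
      have h := (isNilCleanRing_matrix_zmod_two n
        (Matrix.of fun i j => if A i j = 0 then 0 else 1)).map f.mapMatrix
      convert! h using 1
      ext i j
      rcases hA i j (Finset.notMem_empty _) with h | h <;> simp [h]
    | insert p s hp ih =>
      intro A hA
      let F : B → Matrix (Fin n) (Fin n) B := fun x =>
        Matrix.of fun i j => if (i, j) = p then x else A i j
      have hF : ∀ x, x = 0 ∨ x = 1 → IsNilCleanElem (F x) := by
        intro x hx
        refine ih _ fun i j hij => ?_
        by_cases h : (i, j) = p
        · simpa [F, h] using hx
        · simpa [F, h] using hA i j (by simp [h, hij])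
      convert! (hF 1 (.inr rfl)).smul_add_one_sub_smul (hF 0 (.inl rfl)) (A p.1 p.2) using 1
      ext i j
      by_cases h : (i, j) = p
      · subst h; simp [F]
      · simp only [F, Matrix.add_apply, Matrix.smul_apply, Matrix.of_apply, if_neg h, smul_eq_mul]
        ring
  exact fun A => key Finset.univ A fun i j h => absurd (Finset.mem_univ _) h

end Boolean

/-! ### The prime radical and matrices over it -/

section PrimeRadical

variable {R : Type*} [Ring R]

/-- An ideal maximal among those avoiding all powers of `x` is prime: if `P + A` and `P + B` contain
powers of `x`, their product would lie in `P` when `A B ⊆ P`. -/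
theorem exists_isPrimeTwoSided_notMem {x : R} (hx : ¬ IsNilpotent x) :
    ∃ P : TwoSidedIdeal R, IsPrimeTwoSided P ∧ x ∉ P := by
  obtain ⟨P, hP⟩ : ∃ P, Maximal (· ∈ {I : TwoSidedIdeal R | ∀ k : ℕ, x ^ k ∉ I}) P := by
    refine zorn_le₀ _ fun c hc hchain => ?_
    rcases c.eq_empty_or_nonempty with rfl | ⟨I₀, hI₀⟩
    · exact ⟨⊥, fun k hk => hx ⟨k, (TwoSidedIdeal.mem_bot R).mp hk⟩, by simp⟩
    · refine ⟨TwoSidedIdeal.mk' {y | ∃ I ∈ c, y ∈ I} ⟨I₀, hI₀, I₀.zero_mem⟩ ?_ ?_ ?_ ?_,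
        fun k hk => ?_, fun I hI y hy => ?_⟩
      · rintro y z ⟨I, hI, hy⟩ ⟨I', hI', hz⟩
        rcases hchain.total hI hI' with h | h
        · exact ⟨I', hI', I'.add_mem (h hy) hz⟩
        · exact ⟨I, hI, I.add_mem hy (h hz)⟩
      · rintro y ⟨I, hI, hy⟩
        exact ⟨I, hI, I.neg_mem hy⟩
      · rintro y z ⟨I, hI, hz⟩
        exact ⟨I, hI, I.mul_mem_left _ _ hz⟩
      · rintro y z ⟨I, hI, hy⟩
        exact ⟨I, hI, I.mul_mem_right _ _ hy⟩
      · rw [TwoSidedIdeal.mem_mk'] at hk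
        obtain ⟨I, hI, hk⟩ := hk
        exact hc hI k hk
      · rw [TwoSidedIdeal.mem_mk']
        exact ⟨I, hI, hy⟩
  have hpow : ∀ A : TwoSidedIdeal R, ¬ A ≤ P → ∃ k : ℕ, ∃ p ∈ P, ∃ a ∈ A, p + a = x ^ k := by
    intro A hA
    by_contra! h
    refine hA (le_sup_right.trans (hP.le_of_ge (y := P ⊔ A) (fun k hk => ?_) le_sup_left))
    obtain ⟨p, hp, a, ha, e⟩ := TwoSidedIdeal.mem_sup.mp hk
    exact h k p hp a ha e
  refine ⟨P, ⟨fun h => hP.prop 0 (h ▸ TwoSidedIdeal.mem_top R), fun A B hAB => ?_⟩,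
    fun h => hP.prop 1 (by rwa [pow_one])⟩
  by_contra! h
  obtain ⟨i, p, hp, a, ha, hi⟩ := hpow A h.1
  obtain ⟨j, q, hq, b, hb, hj⟩ := hpow B h.2
  refine hP.prop (i + j) ?_
  rw [pow_add, ← hi, ← hj, add_mul, mul_add a]
  exact P.add_mem (P.mul_mem_right _ _ hp) (P.add_mem (P.mul_mem_left _ _ hq) (hAB a ha b hb))

theorem isNilpotent_of_mem_primeRadical {x : R} (hx : x ∈ primeRadical R) : IsNilpotent x := by
  by_contra h
  obtain ⟨P, hP, hxP⟩ := exists_isPrimeTwoSided_notMem h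
  exact hxP ((TwoSidedIdeal.mem_sInf _).mp hx P hP)

theorem IsPrimeTwoSided.of_matrix {ι : Type*} [Fintype ι] [DecidableEq ι] [Nonempty ι]
    {I : TwoSidedIdeal R} (h : IsPrimeTwoSided (I.matrix ι)) : IsPrimeTwoSided I := by
  refine ⟨fun hI => h.1 (by rw [hI, TwoSidedIdeal.matrix_top]), fun A B hAB => ?_⟩
  have hle : ∀ A : TwoSidedIdeal R, A.matrix ι ≤ I.matrix ι → A ≤ I := fun A =>
    (TwoSidedIdeal.orderIsoMatrix (R := R) (n := ι)).le_iff_le.mp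
  refine (h.2 (A.matrix ι) (B.matrix ι) fun X hX Y hY => ?_).imp (hle A) (hle B)
  intro i j
  exact I.finsetSum_mem _ _ fun k _ => hAB _ (hX i k) _ (hY k j)

/-- Every prime ideal of the matrix ring consists of the matrices over some prime ideal of `R`, so
such an `A` lies in the prime radical of the matrix ring, which is nil. -/
theorem isNilpotent_matrix_of_mem_primeRadical {ι : Type*} [Fintype ι] [DecidableEq ι]
    {A : Matrix ι ι R} (hA : ∀ i j, A i j ∈ primeRadical R) : IsNilpotent A := by
  rcases isEmpty_or_nonempty ι with hι | hι
  · exact ⟨1, Subsingleton.elim _ _⟩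
  refine isNilpotent_of_mem_primeRadical ((TwoSidedIdeal.mem_sInf _).mpr fun P hP => ?_)
  obtain ⟨I, rfl⟩ := (TwoSidedIdeal.orderIsoMatrix (R := R) (n := ι)).surjective P
  exact fun i j => (TwoSidedIdeal.mem_sInf _).mp (hA i j) I hP.of_matrix

end PrimeRadical

/-! ### Lifting nil-cleanness modulo nil ideals -/

theorem IsNilCleanElem.of_map {R S : Type*} [Ring R] [Ring S] {f : R →+* S}
    (hf : Function.Surjective f) (hker : ∀ x ∈ RingHom.ker f, IsNilpotent x) {a : R}
    (h : IsNilCleanElem (f a)) : IsNilCleanElem a := by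
  obtain ⟨e, q, he, ⟨m, hq⟩, ha⟩ := h
  obtain ⟨e', he', rfl⟩ := exists_isIdempotentElem_eq_of_ker_isNilpotent f hker e (hf e) he
  have hm : (a - e') ^ m ∈ RingHom.ker f := by
    rw [RingHom.mem_ker, map_pow, map_sub, ha, add_sub_cancel_left, hq]
  obtain ⟨k, hk⟩ := hker _ hm
  exact ⟨e', a - e', he', ⟨m * k, by rw [pow_mul, hk]⟩, (add_sub_cancel e' a).symm⟩

/-- The `BooleanRing` structure on a ring all of whose elements are idempotent. -/
abbrev IsBooleanRing.booleanRing {B : Type*} [i : Ring B] (hB : IsBooleanRing B) : BooleanRing B :=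
  { toRing := i, isIdempotentElem := fun a => hB a }

theorem IsBooleanRing.isNilCleanRing_matrix {B : Type*} [Ring B] (hB : IsBooleanRing B) (n : ℕ) :
    IsNilCleanRing (Matrix (Fin n) (Fin n) B) :=
  @isNilCleanRing_matrix_boolean B hB.booleanRing n

namespace IsTwoPrimal

variable {R : Type*} [Ring R]

theorem mem_primeRadical_iff (hR : IsTwoPrimal R) {x : R} :
    x ∈ (primeRadical R).asIdeal ↔ IsNilpotent x :=
  (Set.ext_iff.mp hR x).symm

theorem isReduced_quotient (hR : IsTwoPrimal R) : IsReduced (R ⧸ (primeRadical R).asIdeal) := by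
  refine ⟨fun x ⟨k, hk⟩ => ?_⟩
  obtain ⟨x, rfl⟩ := Ideal.Quotient.mk_surjective x
  rw [← map_pow, Ideal.Quotient.eq_zero_iff_mem, hR.mem_primeRadical_iff] at hk
  rw [Ideal.Quotient.eq_zero_iff_mem, hR.mem_primeRadical_iff]
  obtain ⟨m, hm⟩ := hk
  exact ⟨k * m, by rw [pow_mul, hm]⟩

theorem isNilCleanRing_matrix (hR : IsTwoPrimal R) (h : ∀ a : R, IsNilpotent (a - a ^ 2))
    (n : ℕ) : IsNilCleanRing (Matrix (Fin n) (Fin n) R) := by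
  intro A
  let f := Ideal.Quotient.mk (primeRadical R).asIdeal
  have hB : IsBooleanRing (R ⧸ (primeRadical R).asIdeal) := fun a => by
    obtain ⟨a, rfl⟩ := Ideal.Quotient.mk_surjective a
    have := Ideal.Quotient.eq_zero_iff_mem.mpr (hR.mem_primeRadical_iff.mpr (h a))
    rw [map_sub, map_pow, sub_eq_zero, pow_two] at this
    exact this.symm
  refine IsNilCleanElem.of_map (f := f.mapMatrix) ?_ (fun X hX => ?_)
    (hB.isNilCleanRing_matrix n _)
  · intro Y
    choose g hg using Ideal.Quotient.mk_surjective (I := (primeRadical R).asIdeal)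
    exact ⟨Y.map g, by ext i j; exact hg _⟩
  · refine isNilpotent_matrix_of_mem_primeRadical fun i j => ?_
    have := Matrix.ext_iff.mpr (RingHom.mem_ker.mp hX) i j
    exact Ideal.Quotient.eq_zero_iff_mem.mp this

end IsTwoPrimal

/-! ### Nilpotence of `a - a ^ 2` and the conditions on `R` -/

section StronglyNilClean

variable {R : Type*} [Ring R]

theorem IsStronglyNilCleanElem.isNilCleanElem {a : R} (h : IsStronglyNilCleanElem a) :
    IsNilCleanElem a :=
  let ⟨e, q, he, hq, _, ha⟩ := h
  ⟨e, q, he, hq, ha⟩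

/-- In the commutative ring `ℤ[a]` the ideal generated by `a - a ^ 2` is nil, and the idempotent
image of `a` modulo it lifts inside `ℤ[a]`. -/
theorem IsStronglyNilCleanElem.of_isNilpotent_sub_sq {a : R} (h : IsNilpotent (a - a ^ 2)) :
    IsStronglyNilCleanElem a := by
  let C := Algebra.adjoin ℤ {a}
  have : IsMulCommutative C := Algebra.isMulCommutative_adjoin ℤ (by rintro _ rfl _ rfl; rfl)
  let a' : C := ⟨a, Algebra.subset_adjoin rfl⟩
  obtain ⟨m, hm⟩ := h
  have ha' : IsNilpotent (a' - a' ^ 2) := ⟨m, Subtype.ext hm⟩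
  let f := Ideal.Quotient.mk (Ideal.span {a' - a' ^ 2})
  have hker : ∀ x ∈ RingHom.ker f, IsNilpotent x := by
    intro x hx
    rw [Ideal.mk_ker, Ideal.mem_span_singleton] at hx
    obtain ⟨y, rfl⟩ := hx
    exact (Commute.all _ _).isNilpotent_mul_right ha'
  have hfa : f a' = f a' ^ 2 := by
    rw [← sub_eq_zero, ← map_pow, ← map_sub, Ideal.Quotient.eq_zero_iff_mem]
    exact Ideal.mem_span_singleton_self _
  obtain ⟨e, he, hea⟩ := exists_isIdempotentElem_eq_of_ker_isNilpotent f hker (f a') ⟨a', rfl⟩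
    (by rw [IsIdempotentElem, ← pow_two, ← hfa])
  obtain ⟨k, hk⟩ := hker (a' - e) (by rw [RingHom.mem_ker, map_sub, hea, sub_self])
  exact ⟨e, a - e, congrArg Subtype.val he.eq, ⟨k, congrArg Subtype.val hk⟩,
    congrArg Subtype.val (mul_comm e (a' - e)), (add_sub_cancel _ _).symm⟩

theorem IsTwoPrimal.isNilpotent_sub_sq (hR : IsTwoPrimal R) {a : R} (h : IsNilCleanElem a) :
    IsNilpotent (a - a ^ 2) := by
  obtain ⟨e, q, he, hq, rfl⟩ := h
  rw [← hR.mem_primeRadical_iff] at hq ⊢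
  rw [← Ideal.Quotient.eq_zero_iff_mem] at hq ⊢
  rw [map_sub, map_pow, map_add, hq, add_zero, pow_two, ← map_mul, he.eq, sub_self]

theorem isBooleanRing_quotient_jacobson_iff (hR : IsTwoPrimal R) :
    (IsBooleanRing (R ⧸ Ring.jacobson R) ∧ ∀ x ∈ Ring.jacobson R, IsNilpotent x) ↔
      ∀ a : R, IsNilpotent (a - a ^ 2) := by
  constructor
  · rintro ⟨hB, hJ⟩ a
    refine hJ _ (Ideal.Quotient.eq_zero_iff_mem.mp ?_)
    rw [map_sub, map_pow, pow_two, hB, sub_self]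
  · intro h
    have hJ : ∀ x, x ∈ Ring.jacobson R ↔ IsNilpotent x := by
      intro x
      rw [← Ideal.jacobson_bot]
      constructor
      · intro hx
        rw [Ideal.mem_jacobson_iff] at hx
        -- `z` is a left inverse of `1 - x`; it cancels that factor from `x - x ^ 2 = (1 - x) * x`,
        -- which lies in the prime radical.
        obtain ⟨z, hz⟩ := hx (-1)
        have hz' : z * (1 - x) = 1 := by
          rw [Ideal.mem_bot] at hz
          rw [← sub_eq_zero, ← hz]
          noncomm_ring
        have hx2 := hR.mem_primeRadical_iff.mpr (h x)
        rw [← hR.mem_primeRadical_iff]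
        have := (primeRadical R).asIdeal.mul_mem_left z hx2
        rwa [show z * (x - x ^ 2) = z * (1 - x) * x by noncomm_ring, hz', one_mul] at this
      · intro hx
        rw [Ideal.mem_jacobson_iff]
        intro y
        have hyx : IsNilpotent (y * x) := hR.mem_primeRadical_iff.mp
          ((primeRadical R).asIdeal.mul_mem_left y (hR.mem_primeRadical_iff.mpr hx))
        obtain ⟨u, hu⟩ := hyx.isUnit_one_add
        refine ⟨↑u⁻¹, ?_⟩
        rw [Ideal.mem_bot, sub_eq_zero, ← Units.inv_mul u, hu]
        noncomm_ring
    refine ⟨fun a => ?_, fun x hx => (hJ x).mp hx⟩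
    obtain ⟨a, rfl⟩ := Ideal.Quotient.mk_surjective a
    have := Ideal.Quotient.eq_zero_iff_mem.mpr ((hJ _).mpr (h a))
    rw [map_sub, map_pow, sub_eq_zero, pow_two] at this
    exact this.symm

end StronglyNilClean

/-! ### Consequences of a GNC matrix ring -/

section GNC

variable {R S : Type*} [Ring R] [Ring S]

theorem IsGNCRing.of_surjective {f : R →+* S} (hf : Function.Surjective f) (h : IsGNCRing R) :
    IsGNCRing S := by
  intro a ha
  obtain ⟨a, rfl⟩ := hf a
  exact (h a fun hu => ha (hu.map f)).map f

theorem IsGNCRing.matrix_of_surjective {ι : Type*} [Fintype ι] [DecidableEq ι] {f : R →+* S}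
    (hf : Function.Surjective f) (h : IsGNCRing (Matrix ι ι R)) : IsGNCRing (Matrix ι ι S) := by
  refine h.of_surjective (f := f.mapMatrix) fun Y => ?_
  choose g hg using hf
  exact ⟨Y.map g, by ext i j; exact hg _⟩

/-- Generalized nil-clean rings are clean. -/
theorem IsGNCRing.exists_isIdempotentElem_add_unit (h : IsGNCRing R) (a : R) :
    ∃ (e : R) (u : Rˣ), IsIdempotentElem e ∧ a = e + u := by
  by_cases ha : IsUnit a
  · obtain ⟨u, rfl⟩ := ha
    exact ⟨0, u, .zero, (zero_add _).symm⟩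
  -- If `a - 1 = e + q` is nil-clean, then `a = e + (1 + q)` with `1 + q` a unit.
  by_cases ha' : IsUnit (a - 1)
  · obtain ⟨u, hu⟩ := ha'
    exact ⟨1, u, .one, by rw [hu, add_sub_cancel]⟩
  · obtain ⟨e, q, he, hq, hae⟩ := h _ ha'
    obtain ⟨u, hu⟩ := hq.isUnit_one_add
    refine ⟨e, u, he, ?_⟩
    rw [hu, ← sub_add_cancel a 1, hae]
    abel

/-- Generalized nil-clean rings are exchange rings. -/
theorem IsGNCRing.exists_isIdempotentElem_mul (h : IsGNCRing R) (a : R) :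
    ∃ y z : R, IsIdempotentElem (y * a) ∧ 1 - y * a = z * (1 - a) := by
  obtain ⟨e, u, he, rfl⟩ := h.exists_isIdempotentElem_add_unit a
  have hee : e * e = e := he
  have hx : (↑u⁻¹ : R) * (1 - e) * u = (↑u⁻¹ * (1 - e)) * (e + u) := by
    have h0 : (1 - e) * e = 0 := by rw [sub_mul, one_mul, hee, sub_self]
    rw [mul_add, mul_assoc _ (1 - e) e, h0, mul_zero, zero_add]
  have hu : (↑u⁻¹ : R) * u = 1 := u.inv_mul
  have hu' : (u : R) * ↑u⁻¹ = 1 := u.mul_inv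
  -- With this choice `y * a` is the conjugate `u⁻¹ (1 - e) u`, and `e (1 - a) = -e u` yields `z`.
  refine ⟨↑u⁻¹ * (1 - e), -(↑u⁻¹ * e), ?_, ?_⟩
  · rw [← hx]
    have h1 : (1 - e) * (1 - e) = 1 - e := he.one_sub.eq
    calc (↑u⁻¹ : R) * (1 - e) * u * (↑u⁻¹ * (1 - e) * u)
        = ↑u⁻¹ * ((1 - e) * (u * ↑u⁻¹) * (1 - e)) * u := by noncomm_ring
      _ = ↑u⁻¹ * (1 - e) * u := by rw [hu', mul_one, h1]
  · have h1 : e * (1 - (e + u)) = -(e * u) := by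
      rw [mul_sub, mul_one, mul_add, hee]
      abel
    calc 1 - (↑u⁻¹ : R) * (1 - e) * (e + u) = ↑u⁻¹ * e * u := by
          rw [← hx, mul_sub, mul_one, sub_mul, hu, sub_sub_cancel]
      _ = -(↑u⁻¹ * e) * (1 - (e + u)) := by
          rw [neg_mul, mul_assoc, mul_assoc, h1, mul_neg, neg_neg]

/-- This is where `n ≥ 2` enters: some row vanishes, so GNC applies to these matrices for every `a`.
-/
theorem not_isUnit_single {ι : Type*} [Fintype ι] [DecidableEq ι] [Nontrivial ι] [Nontrivial R]
    (i : ι) (a : R) : ¬ IsUnit (Matrix.single i i a) := by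
  rintro ⟨u, hu⟩
  obtain ⟨j, hj⟩ := exists_ne i
  have h := congrFun (congrFun u.mul_inv j) j
  rw [hu] at h
  simp [hj] at h

/-- `Y * single i i a` is supported in column `i`, so its `(i, i)` entry inherits idempotence. -/
theorem IsGNCRing.exists_isIdempotentElem_mul_of_matrix {ι : Type*} [Fintype ι] [DecidableEq ι]
    [Nonempty ι] (h : IsGNCRing (Matrix ι ι R)) (a : R) :
    ∃ y z : R, IsIdempotentElem (y * a) ∧ 1 - y * a = z * (1 - a) := by
  obtain ⟨i⟩ := ‹Nonempty ι›
  obtain ⟨Y, Z, hY, hZ⟩ := h.exists_isIdempotentElem_mul (Matrix.single i i a)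
  refine ⟨Y i i, Z i i, ?_, ?_⟩
  · have h' := congrFun (congrFun hY.eq i) i
    rw [← mul_assoc, Matrix.mul_single_apply_same, Matrix.mul_single_apply_same, Matrix.mul_apply,
      Finset.sum_eq_single i (fun k _ hk => by
        rw [Matrix.mul_single_apply_of_ne _ _ _ _ _ hk, zero_mul]) (by simp),
      Matrix.mul_single_apply_same, mul_assoc] at h'
    exact h'
  · have h' := congrFun (congrFun hZ i) i
    rwa [mul_sub, mul_one, Matrix.sub_apply, Matrix.sub_apply, Matrix.one_apply_eq,
      Matrix.mul_single_apply_same, Matrix.mul_single_apply_same, ← mul_one_sub] at h'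

theorem IsIdempotentElem.commute_of_isReduced [IsReduced R] {g : R} (hg : IsIdempotentElem g)
    (a : R) : Commute g a := by
  have h0 : (1 - g) * g = 0 := hg.one_sub_mul_self
  have h0' : g * (1 - g) = 0 := hg.mul_one_sub_self
  have h₁ : g * a * (1 - g) = 0 := by
    refine eq_zero_of_pow_eq_zero (n := 2) ?_
    calc (g * a * (1 - g)) ^ 2 = g * a * ((1 - g) * g) * a * (1 - g) := by noncomm_ring
      _ = 0 := by rw [h0]; simp
  have h₂ : (1 - g) * a * g = 0 := by
    refine eq_zero_of_pow_eq_zero (n := 2) ?_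
    calc ((1 - g) * a * g) ^ 2 = (1 - g) * a * (g * (1 - g)) * a * g := by noncomm_ring
      _ = 0 := by rw [h0']; simp
  rw [mul_sub, mul_one, sub_eq_zero] at h₁
  rw [sub_mul, sub_mul, one_mul, sub_eq_zero] at h₂
  exact h₁.trans h₂.symm

/-- In a reduced exchange ring, maximal left ideals are two-sided. -/
theorem Ideal.IsMaximal.isTwoSided_of_exchange [IsReduced R]
    (h : ∀ a : R, ∃ y z : R, IsIdempotentElem (y * a) ∧ 1 - y * a = z * (1 - a))
    {L : Ideal R} (hL : L.IsMaximal) : L.IsTwoSided := by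
  refine ⟨fun {a} s ha => ?_⟩
  by_contra has
  obtain ⟨r, l, hl, hr⟩ := hL.exists_inv has
  obtain ⟨y, z, hg, hz⟩ := h (r * (a * s))
  rw [← sub_eq_iff_eq_add'.mpr hr.symm] at hl
  have h1 := L.mul_mem_left z hl
  rw [← hz] at h1
  set c := y * r * a with hc
  have hcL : c ∈ L := L.mul_mem_left _ ha
  rw [show y * (r * (a * s)) = c * s by rw [hc]; noncomm_ring] at hg h1
  have hg' : c * s * (c * s) = c * s := hg
  -- Rotating the idempotent `c s` gives an idempotent in `R c ⊆ L`. It is central, as `R` is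
  -- reduced, and it absorbs `c s`; so `L` contains both `c s` and `1 - c s`.
  have hh : IsIdempotentElem (s * c * s * c) := by
    calc s * c * s * c * (s * c * s * c) = s * (c * s * (c * s) * (c * s)) * c := by noncomm_ring
      _ = s * c * s * c := by rw [hg', hg']; noncomm_ring
  have key : c * s = c * s * (s * c * s * c) := by
    calc c * s = c * s * (c * s) * (c * s) := by rw [hg', hg']
      _ = c * (s * c * s * c * s) := by noncomm_ring
      _ = c * (s * (s * c * s * c)) := by rw [(hh.commute_of_isReduced s).eq]
      _ = c * s * (s * c * s * c) := by noncomm_ring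
  refine hL.ne_top ((Ideal.eq_top_iff_one L).mpr ?_)
  rw [← sub_add_cancel 1 (c * s)]
  refine L.add_mem h1 ?_
  rw [key]
  exact L.mul_mem_left _ (L.mul_mem_left _ hcL)

theorem IsNilpotent.eq_zero_or_eq_zero_of_vecMul {D ι : Type*} [DivisionRing D] [Fintype ι]
    [DecidableEq ι] {Q : Matrix ι ι D} (hQ : IsNilpotent Q) {x : ι → D} {c : D}
    (hx : Matrix.vecMul x Q = c • x) : c = 0 ∨ x = 0 := by
  obtain ⟨m, hm⟩ := hQ
  have h : ∀ k, Matrix.vecMul x (Q ^ k) = c ^ k • x := by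
    intro k
    induction k with
    | zero => simp
    | succ k ih => rw [_root_.pow_succ, ← Matrix.vecMul_vecMul, ih, Matrix.smul_vecMul, hx,
        smul_smul, ← _root_.pow_succ]
  have := h m
  rw [hm, Matrix.vecMul_zero] at this
  exact (smul_eq_zero.mp this.symm).imp_left eq_zero_of_pow_eq_zero

/-- Row vectors make right multiplication by a matrix linear for left scalars. On the row space of
`E`, `Q` is `-1` on vectors with zero `i`-th coordinate, so this space has dimension at most one. If
it is spanned by `w`, then `e` and `w` span a `Q`-invariant space; a nonzero vector of it killed by
`Q` leads to an eigenvector of `Q` with eigenvalue `a - 1`, unless `a` is 0 or 1 outright. -/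
theorem eq_zero_or_eq_one_of_isNilCleanElem_single {D ι : Type*} [DivisionRing D] [Fintype ι]
    [DecidableEq ι] {i : ι} {a : D} (h : IsNilCleanElem (Matrix.single i i a)) :
    a = 0 ∨ a = 1 := by
  obtain ⟨E, Q, hE, hQ, hA⟩ := h
  let e : ι → D := Pi.single i 1
  have hei : e i = 1 := Pi.single_eq_same i 1
  have he0 : e ≠ 0 := fun h => one_ne_zero (α := D) (by rw [← hei, h, Pi.zero_apply])
  have hEE : ∀ y, Matrix.vecMul (Matrix.vecMul y E) E = Matrix.vecMul y E := fun y => by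
    rw [Matrix.vecMul_vecMul, hE.eq]
  have hyQ : ∀ y, Matrix.vecMul y Q = (y i * a) • e - Matrix.vecMul y E := fun y => by
    rw [eq_sub_iff_add_eq', ← Matrix.vecMul_add, ← hA]
    ext j
    by_cases hj : j = i
    · subst hj; simp [Matrix.vecMul, dotProduct, Matrix.single_apply, e]
    · simp [Matrix.vecMul, dotProduct, e, hj, Ne.symm hj]
  have hinj : ∀ x, Matrix.vecMul x E = x → x i = 0 → x = 0 := fun x hx hxi => by
    refine (hQ.eq_zero_or_eq_zero_of_vecMul (x := x) (c := -1) ?_).resolve_left (by simp)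
    rw [hyQ, hx, hxi, zero_mul, zero_smul, zero_sub, neg_one_smul]
  by_cases hall : ∀ y, Matrix.vecMul y E = 0
  · left
    refine (hQ.eq_zero_or_eq_zero_of_vecMul (x := e) ?_).resolve_right he0
    rw [hyQ, hall, sub_zero, hei, one_mul]
  push Not at hall
  obtain ⟨y₀, hy₀⟩ := hall
  have hy₀i : (Matrix.vecMul y₀ E) i ≠ 0 := fun h => hy₀ (hinj _ (hEE y₀) h)
  obtain ⟨w, hwE, hwi⟩ : ∃ w : ι → D, Matrix.vecMul w E = w ∧ w i = 1 :=
    ⟨((Matrix.vecMul y₀ E) i)⁻¹ • Matrix.vecMul y₀ E, by rw [Matrix.smul_vecMul, hEE],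
      inv_mul_cancel₀ hy₀i⟩
  have hyE : ∀ y, Matrix.vecMul y E = (Matrix.vecMul y E) i • w := fun y => by
    rw [← sub_eq_zero]
    refine hinj _ ?_ ?_
    · rw [Matrix.sub_vecMul, Matrix.smul_vecMul, hEE, hwE]
    · simp [hwi]
  set t := (Matrix.vecMul e E) i
  have heQ : Matrix.vecMul e Q = a • e - t • w := by rw [hyQ, hei, one_mul, hyE e]
  have hwQ : Matrix.vecMul w Q = a • e - w := by rw [hyQ, hwi, one_mul, hwE]
  by_contra! ha
  have ha1 : a - 1 ≠ 0 := sub_ne_zero.mpr ha.2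
  have hlin : ∀ α β : D, Matrix.vecMul (α • e + β • w) Q =
      ((α + β) * a) • e - (α * t + β) • w := fun α β => by
    rw [Matrix.add_vecMul, Matrix.smul_vecMul, Matrix.smul_vecMul, heQ, hwQ]
    simp only [smul_sub, smul_smul, add_mul, add_smul]
    abel
  have hspan : ∀ m, ∃ α β : D, Matrix.vecMul e (Q ^ m) = α • e + β • w := by
    intro m
    induction m with
    | zero => exact ⟨1, 0, by simp⟩
    | succ m ih =>
      obtain ⟨α, β, h⟩ := ih
      refine ⟨(α + β) * a, -(α * t + β), ?_⟩
      rw [pow_succ, ← Matrix.vecMul_vecMul, h, hlin, neg_smul, sub_eq_add_neg]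
  have hex : ∃ m, Matrix.vecMul e (Q ^ m) = 0 := by
    obtain ⟨m, hm⟩ := hQ
    exact ⟨m, by rw [hm, Matrix.vecMul_zero]⟩
  classical
  obtain ⟨m, hm⟩ : ∃ m, Nat.find hex = m + 1 := by
    refine Nat.exists_eq_succ_of_ne_zero fun h => he0 ?_
    have := Nat.find_spec hex
    rwa [h, pow_zero, Matrix.vecMul_one] at this
  -- The last nonzero vector among the `e Q ^ m` lies in the kernel of `Q`.
  obtain ⟨α, β, hαβ⟩ := hspan m
  have hne : α • e + β • w ≠ 0 := hαβ ▸ Nat.find_min hex (by omega)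
  have hk : ((α + β) * a) • e - (α * t + β) • w = 0 := by
    rw [← hlin, ← hαβ, Matrix.vecMul_vecMul, ← pow_succ, ← hm]
    exact Nat.find_spec hex
  have hki : (α + β) * a = α * t + β := by
    have := congrFun hk i
    simpa [hei, hwi, sub_eq_zero] using this
  rw [hki, ← smul_sub] at hk
  rcases smul_eq_zero.mp hk with hc | hew
  · rw [hc] at hki
    have hβ : α + β = 0 := (mul_eq_zero.mp hki).resolve_right ha.1
    have hα : α ≠ 0 := by
      rintro rfl
      rw [zero_add] at hβ
      simp [hβ] at hne
    have ht : t = 1 := by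
      have : α * (t - 1) = 0 := by
        rw [mul_sub, mul_one, ← hc, eq_neg_of_add_eq_zero_left hβ]
        abel
      exact sub_eq_zero.mp ((mul_eq_zero.mp this).resolve_left hα)
    rw [ht, one_smul] at heQ
    rcases hQ.eq_zero_or_eq_zero_of_vecMul (x := a • e - w) (c := a - 1) (by
      rw [Matrix.sub_vecMul, Matrix.smul_vecMul, heQ, hwQ, sub_smul, one_smul]) with h | h
    · exact ha1 h
    · have := congrFun h i
      simp [hei, hwi] at this
      exact ha1 this
  · rw [← sub_eq_zero.mp hew] at hwQ
    rcases hQ.eq_zero_or_eq_zero_of_vecMul (x := e) (c := a - 1)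
      (by rw [hwQ, sub_smul, one_smul]) with h | h
    · exact ha1 h
    · exact he0 h

/-- Elements of the Jacobson radical of a ring with generalized nil-clean matrix ring are
nilpotent. -/
theorem IsGNCRing.isNilpotent_of_mem_jacobson {ι : Type*} [Fintype ι] [DecidableEq ι]
    [Nontrivial ι] (h : IsGNCRing (Matrix ι ι R)) {x : R} (hx : x ∈ Ring.jacobson R) :
    IsNilpotent x := by
  rcases subsingleton_or_nontrivial R with hR | hR
  · exact ⟨1, Subsingleton.elim _ _⟩
  obtain ⟨i⟩ : Nonempty ι := inferInstance
  obtain ⟨E, Q, hE, hQ, hA⟩ := h _ (not_isUnit_single i x)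
  obtain ⟨u, hu⟩ := hQ.isUnit_one_add
  rw [← Ideal.jacobson_bot] at hx
  have hX := Ideal.single_mem_jacobson_matrix (⊥ : Ideal R) x hx i i
  rw [Ideal.matrix_bot, Ideal.mem_jacobson_iff] at hX
  obtain ⟨Z, hZ⟩ := hX (-↑u⁻¹)
  rw [Ideal.mem_bot, sub_eq_zero] at hZ
  -- The second factor is left invertible, as the matrix lies in the Jacobson radical. Hence so is
  -- the idempotent `1 - E`, which must be 1.
  have hEu : 1 - E = u * (1 - (↑u⁻¹ : Matrix ι ι R) * Matrix.single i i x) := by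
    rw [mul_sub, mul_one, ← mul_assoc, u.mul_inv, one_mul, hu, hA]
    abel
  have hE0 : E = 0 := by
    have h1 : Z * (↑u⁻¹ : Matrix ι ι R) * (1 - E) = 1 := by
      rw [hEu, mul_assoc Z, ← mul_assoc (↑u⁻¹ : Matrix ι ι R), u.inv_mul, one_mul]
      refine Eq.trans ?_ hZ
      noncomm_ring
    rw [← one_mul E, ← h1, mul_assoc, hE.one_sub_mul_self, mul_zero]
  rw [hE0, zero_add] at hA
  rw [← hA] at hQ
  obtain ⟨m, hm⟩ := hQ
  refine ⟨m, ?_⟩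
  have hpow : ∀ k, (Matrix.single i i x ^ k) i i = x ^ k := by
    intro k
    induction k with
    | zero => simp
    | succ k ih => rw [pow_succ, Matrix.mul_single_apply_same, ih, _root_.pow_succ]
  rw [← hpow, hm, Matrix.zero_apply]

theorem IsGNCRing.sq_eq_self_of_isReduced [IsReduced R] {ι : Type*} [Fintype ι] [DecidableEq ι]
    [Nontrivial ι] (h : IsGNCRing (Matrix ι ι R)) (a : R) : a ^ 2 = a := by
  rw [← sub_eq_zero]
  refine (h.isNilpotent_of_mem_jacobson ?_).eq_zero
  rw [Ring.jacobson_eq_sInf_isMaximal, Submodule.mem_sInf]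
  intro L hL
  have := hL.isTwoSided_of_exchange h.exists_isIdempotentElem_mul_of_matrix
  have : Nontrivial (R ⧸ L) := Ideal.Quotient.nontrivial_iff.mpr hL.ne_top
  -- Maximality of `L` as a left ideal gives only left inverses; applying this twice makes them
  -- two-sided.
  let D : DivisionRing (R ⧸ L) := DivisionRing.ofIsUnitOrEqZero fun b => by
    have hinv : ∀ b : R ⧸ L, b ≠ 0 → ∃ c, c * b = 1 := fun b hb => by
      obtain ⟨b, rfl⟩ := Ideal.Quotient.mk_surjective b
      obtain ⟨c, l, hl, hc⟩ := hL.exists_inv (mt Ideal.Quotient.eq_zero_iff_mem.mpr hb)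
      refine ⟨Ideal.Quotient.mk L c, ?_⟩
      rw [← map_mul, ← add_zero (Ideal.Quotient.mk L _), ← Ideal.Quotient.eq_zero_iff_mem.mpr hl,
        ← map_add, hc, map_one]
    refine or_iff_not_imp_right.mpr fun hb => ?_
    obtain ⟨c, hc⟩ := hinv b hb
    obtain ⟨d, hd⟩ := hinv c fun h => by simp [h] at hc
    rw [left_inv_eq_right_inv hd hc] at hd
    exact ⟨⟨b, c, hd, hc⟩, rfl⟩
  obtain ⟨i⟩ : Nonempty ι := inferInstance
  have hD : IsGNCRing (Matrix ι ι (R ⧸ L)) :=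
    h.matrix_of_surjective (f := Ideal.Quotient.mk L) Ideal.Quotient.mk_surjective
  rw [← Ideal.Quotient.eq_zero_iff_mem, map_sub, map_pow]
  rcases eq_zero_or_eq_one_of_isNilCleanElem_single
    (hD _ (not_isUnit_single i (Ideal.Quotient.mk L a))) with h | h <;> rw [h] <;> simp

end GNC

theorem mainTheorem9 {R : Type*} [Ring R] (hR : IsTwoPrimal R) (n : ℕ) (hn : 2 ≤ n) :
    (IsGNCRing (Matrix (Fin n) (Fin n) R) ↔
      IsBooleanRing (R ⧸ Ring.jacobson R) ∧ ∀ x ∈ Ring.jacobson R, IsNilpotent x) ∧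
    (IsGNCRing (Matrix (Fin n) (Fin n) R) ↔ IsStronglyNilCleanRing R) ∧
    (IsGNCRing (Matrix (Fin n) (Fin n) R) ↔ IsNilCleanRing R) := by
  have hGNC : IsGNCRing (Matrix (Fin n) (Fin n) R) ↔ ∀ a : R, IsNilpotent (a - a ^ 2) := by
    refine ⟨fun h a => ?_, fun h A _ => hR.isNilCleanRing_matrix h n A⟩
    have : Nontrivial (Fin n) := Fin.nontrivial_iff_two_le.mpr hn
    have := hR.isReduced_quotient
    have ha := (h.matrix_of_surjective (f := Ideal.Quotient.mk (primeRadical R).asIdeal)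
      Ideal.Quotient.mk_surjective).sq_eq_self_of_isReduced (Ideal.Quotient.mk _ a)
    rw [← hR.mem_primeRadical_iff, ← Ideal.Quotient.eq_zero_iff_mem, map_sub, map_pow, ha,
      sub_self]
  refine ⟨hGNC.trans (isBooleanRing_quotient_jacobson_iff hR).symm, hGNC.trans ⟨fun h a =>
    .of_isNilpotent_sub_sq (h a), fun h a => hR.isNilpotent_sub_sq (h a).isNilCleanElem⟩,
    hGNC.trans ⟨fun h a => (IsStronglyNilCleanElem.of_isNilpotent_sub_sq (h a)).isNilCleanElem,
    fun h a => hR.isNilpotent_sub_sq (h a)⟩⟩
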